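/- Let $p$ be a probability mass function on $\mathbb Z$ with finite support and let $X_1$ be a random variable with law $p$. Put $\mu := \mathbb E[X_1]$, $e(\lambda) := \mathbb E[e^{\lambda X_1}]$ for $\lambda\in\mathbb R$, and $$I(x) := \sup_{\lambda\in\mathbb R}\{x\lambda - e(\lambda)+1\}\in[0,\infty],\qquad x\in\mathbb R .$$ Let $U_0=(U_{0,v})_{v\in\mathbb Z}$ be a probability distribution on $\mathbb Z$ with finite support, and consider the infinite color urn model with initial configuration $U_0$ and replacement matrix $R(u,v)=p(v-u)$, $u,v\in\mathbb Z$. That is, at each time $n\ge 0$ a color $Z_n\in\mathbb Z$ is selected with $$\mathbb P(Z_n=v\mid U_n,\dots,U_0)=\frac{U_{n,v}}{\sum_{w}U_{n,w}}=\frac{U_{n,v}}{n+1},\qquad v\in\mathbb Z,$$ and then $U_{n+1,v}=U_{n,v}+p(v-Z_n)$ for all $v\in\mathbb Z$; so $Z_n$ is the $(n+1)$-st selected color. Then for every $\varepsilon>0$, with the convention $\log 0=-\infty$ and limits taken in $[-\infty,\infty]$, $$\lim_{n\to\infty}\frac1{\log n}\log\mathbb P\Big(\frac{Z_n}{\log n}\ge\mu+\varepsilon\Big)=-I(\mu+\varepsilon),$$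 except in the degenerate case in which simultaneously $\mu+\varepsilon=0$, $X_1\le 0$ almost surely, and $U_{0,v}=0$ for all $v\ge 0$; and $$\lim_{n\to\infty}\frac1{\log n}\log\mathbb P\Big(\frac{Z_n}{\log n}\le\mu-\varepsilon\Big)=-I(\mu-\varepsilon),$$ except in the degenerate case in which simultaneously $\mu-\varepsilon=0$, $X_1\ge 0$ almost surely, and $U_{0,v}=0$ for all $v\le 0$. In particular, both limits hold for every $\varepsilon>0$ when $U_0=\delta_0$. -/

import Mathlib

open MeasureTheory ProbabilityTheory Filter Topology

noncomputable section

/-- The configuration of the urn with colours in `ℤ` at each time, given the initial configuration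
`U₀` and the sequence `z 0, z 1, …` of selected colours.  When colour `V = z n` is selected, row `V`
of the transition matrix `R u v = p (v - u)` of the random walk with step law `p` is added. -/
def urnConfig (p U₀ : PMF ℤ) (z : ℕ → ℤ) : ℕ → ℤ → ℝ
  | 0 => fun v => (U₀ v).toReal
  | n + 1 => fun v => urnConfig p U₀ z n v + (p (v - z n)).toReal

/-- The σ-algebra generated by the random configurations at times `0, …, n`, where `Z k` is the
colour selected from the configuration at time `k`. -/
abbrev urnHistory {Ω : Type*} (p U₀ : PMF ℤ) (Z : ℕ → Ω → ℤ) (n : ℕ) : MeasurableSpace Ω :=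
  ⨆ k ∈ Set.Iic n,
    MeasurableSpace.comap (fun ω => urnConfig p U₀ (fun j => Z j ω) k) inferInstance

/-- `Z` is the sequence of selected colours of the infinite colour urn model with initial
configuration `U₀`, associated with the random walk with step law `p`: given the configurations up
to time `n`, the `(n + 1)`-st selected colour `Z n` equals `v` with probability proportional to the
weight of the colour `v` in the urn at time `n`. -/
structure IsUrnSelection {Ω : Type*} [MeasurableSpace Ω] (P : Measure Ω) (p U₀ : PMF ℤ)
    (Z : ℕ → Ω → ℤ) : Prop where
  measurable : ∀ n, Measurable (Z n)
  condProb : ∀ (n : ℕ) (v : ℤ),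
    P[Set.indicator {ω | Z n ω = v} (fun _ => (1 : ℝ)) | urnHistory p U₀ Z n] =ᵐ[P]
      fun ω => urnConfig p U₀ (fun j => Z j ω) n v /
        ∑' w : ℤ, urnConfig p U₀ (fun j => Z j ω) n w

/-- The mean of the step law. -/
def stepMean (p : PMF ℤ) : ℝ := ∫ u : ℤ, (u : ℝ) ∂p.toMeasure

/-- The moment generating function of the step law. -/
def stepMGF (p : PMF ℤ) (t : ℝ) : ℝ := ∫ u : ℤ, Real.exp (t * (u : ℝ)) ∂p.toMeasure

/-- The Fenchel–Legendre dual of `stepMGF p - 1`, with values in `[-∞, ∞]`. -/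
def urnRate (p : PMF ℤ) (x : ℝ) : EReal :=
  ⨆ t : ℝ, ((x * t - stepMGF p t + 1 : ℝ) : EReal)

end

open scoped ENNReal

/-! ### Exact moment generating function of the selected colour -/

section Urn

variable {Ω : Type*} {mΩ : MeasurableSpace Ω} {P : Measure Ω} {p U₀ : PMF ℤ} {Z : ℕ → Ω → ℤ}

/-! The total weight after `n` draws is the deterministic number `n + 1`, so the law of `Z n` is the
expected configuration divided by `n + 1`. Each draw adds a translate of `p`, and exponentials turn
this convolution into a product. Hence the moment generating function of `Z n` is exactly that of
`U₀` times `∏ (k + 1 + e(t)) / (k + 2)` over `k < n`, which has growth exponent `e(t) - 1` in `n`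
(`IsUrnSelection.mgf_eq`, `tendsto_log_prod_div_log`).

What remains is a Gärtner–Ellis argument at speed `log n`. Chernoff's inequality gives the upper
bound. For the lower bound, if `e'(t) = y` then the exponential moment at `t` is carried by values
near `y log n`: a truncation inequality makes the other values negligible (`mgf_le_of_truncation`).
By convexity the supremum defining the rate at `x` is attained where `e'(t) = x`.

For the right tail above the mean, no such `t` need exist if all steps are nonpositive and `x ≥ 0`.
For `x > 0` the rate is infinite and the event is eventually null, because colours never exceed the
initial maximum. For `x = 0` the rate is `1 - p 0`, and the probability of nonnegative colours is
bounded below by letting `t → ∞` in the exact formula; this needs some initial mass on nonnegative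
colours, for otherwise the probability is zero while the rate is finite. The left tail follows by
reflection. -/

theorem PMF.hasSum_toReal {α : Type*} (p : PMF α) : HasSum (fun a => (p a).toReal) 1 := by
  have h := ENNReal.hasSum_toReal (f := fun a => p a) (by simp [p.tsum_coe])
  rwa [← ENNReal.tsum_toReal_eq (fun a => p.apply_ne_top a), p.tsum_coe, ENNReal.toReal_one] at h

theorem urnConfig_nonneg (p U₀ : PMF ℤ) (z : ℕ → ℤ) (n : ℕ) (v : ℤ) :
    0 ≤ urnConfig p U₀ z n v := by
  induction n with
  | zero => exact ENNReal.toReal_nonneg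
  | succ n ih => exact add_nonneg ih ENNReal.toReal_nonneg

theorem hasSum_urnConfig (p U₀ : PMF ℤ) (z : ℕ → ℤ) (n : ℕ) :
    HasSum (urnConfig p U₀ z n) (n + 1) := by
  induction n with
  | zero => simpa [urnConfig] using U₀.hasSum_toReal
  | succ n ih =>
    have h : HasSum (fun v => (p (v - z n)).toReal) 1 :=
      (Equiv.hasSum_iff (f := fun u => (p u).toReal) (Equiv.subRight (z n))).mpr p.hasSum_toReal
    rw [Nat.cast_succ]
    exact ih.add h

theorem urnConfig_le (p U₀ : PMF ℤ) (z : ℕ → ℤ) (n : ℕ) (v : ℤ) :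
    urnConfig p U₀ z n v ≤ n + 1 :=
  le_hasSum (hasSum_urnConfig p U₀ z n) v fun w _ => urnConfig_nonneg p U₀ z n w

theorem measurable_urnConfig (p U₀ : PMF ℤ) (hZ : ∀ n, Measurable (Z n)) (n : ℕ) (v : ℤ) :
    Measurable fun ω => urnConfig p U₀ (fun j => Z j ω) n v := by
  induction n with
  | zero => exact measurable_const
  | succ n ih =>
    exact ih.add ((measurable_of_countable fun u : ℤ => (p (v - u)).toReal).comp (hZ n))

theorem urnHistory_le (p U₀ : PMF ℤ) (hZ : ∀ n, Measurable (Z n)) (n : ℕ) :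
    urnHistory p U₀ Z n ≤ mΩ :=
  iSup₂_le fun k _ =>
    (measurable_pi_iff.mpr fun v => measurable_urnConfig p U₀ hZ k v).comap_le

/-- The expected weight of the colour `v` in the urn at time `n`. -/
noncomputable def urnMean (P : Measure Ω) (p U₀ : PMF ℤ) (Z : ℕ → Ω → ℤ) (n : ℕ) (v : ℤ) : ℝ≥0∞ :=
  ∫⁻ ω, ENNReal.ofReal (urnConfig p U₀ (fun j => Z j ω) n v) ∂P

/-- Integrate the conditional law: its denominator is the constant `n + 1`, so it comes out of the
expectation. -/
theorem IsUrnSelection.urnMean_eq [IsProbabilityMeasure P] (hZ : IsUrnSelection P p U₀ Z)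
    (n : ℕ) (v : ℤ) : urnMean P p U₀ Z n v = (n + 1) * P {ω | Z n ω = v} := by
  have hms : MeasurableSet {ω | Z n ω = v} := hZ.measurable n (measurableSet_singleton v)
  have hm := urnHistory_le p U₀ hZ.measurable n
  have h1 := integral_condExp hm (μ := P)
    (f := Set.indicator {ω | Z n ω = v} (fun _ => (1 : ℝ)))
  rw [integral_congr_ae (hZ.condProb n v), integral_indicator_const _ hms] at h1
  simp only [(hasSum_urnConfig p U₀ _ n).tsum_eq, integral_div, smul_eq_mul, mul_one] at h1
  have hn : (0 : ℝ) < n + 1 := by positivity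
  rw [div_eq_iff hn.ne'] at h1
  have hint : Integrable (fun ω => urnConfig p U₀ (fun j => Z j ω) n v) P :=
    Integrable.of_bound (measurable_urnConfig p U₀ hZ.measurable n v).aestronglyMeasurable
      (n + 1) (ae_of_all _ fun ω => by
        rw [Real.norm_of_nonneg (urnConfig_nonneg ..)]; exact urnConfig_le ..)
  rw [urnMean, ← ofReal_integral_eq_lintegral_ofReal hint
    (ae_of_all _ fun ω => urnConfig_nonneg ..), h1, ENNReal.ofReal_mul measureReal_nonneg,
    ofReal_measureReal, mul_comm]
  congr 1
  rw [ENNReal.ofReal_add (by positivity) zero_le_one]; simp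

theorem lintegral_comp_eq_tsum {f : Ω → ℤ} (hf : Measurable f) (g : ℤ → ℝ≥0∞) :
    ∫⁻ ω, g (f ω) ∂P = ∑' v, g v * P {ω | f ω = v} := by
  rw [← lintegral_map (measurable_of_countable g) hf, lintegral_countable']
  refine tsum_congr fun v => ?_
  rw [Measure.map_apply hf (measurableSet_singleton v)]; rfl

theorem urnMean_succ (p U₀ : PMF ℤ) (hZ : ∀ n, Measurable (Z n)) (n : ℕ) (v : ℤ) :
    urnMean P p U₀ Z (n + 1) v =
      urnMean P p U₀ Z n v + ∑' u, p (v - u) * P {ω | Z n ω = u} := by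
  rw [← lintegral_comp_eq_tsum (hZ n) fun u => p (v - u), urnMean, urnMean,
    ← lintegral_add_left (measurable_urnConfig p U₀ hZ n v).ennreal_ofReal]
  refine lintegral_congr fun ω => ?_
  rw [urnConfig, ENNReal.ofReal_add (urnConfig_nonneg ..) ENNReal.toReal_nonneg,
    ENNReal.ofReal_toReal (p.apply_ne_top _)]

/-- The moment generating function of a law on `ℤ`, with values in `[0, ∞]`. -/
noncomputable def PMF.emgf (p : PMF ℤ) (t : ℝ) : ℝ≥0∞ :=
  ∑' u : ℤ, ENNReal.ofReal (Real.exp (t * u)) * p u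

theorem IsUrnSelection.lintegral_exp_zero [IsProbabilityMeasure P] (hZ : IsUrnSelection P p U₀ Z)
    (t : ℝ) : ∫⁻ ω, ENNReal.ofReal (Real.exp (t * Z 0 ω)) ∂P = U₀.emgf t := by
  rw [lintegral_comp_eq_tsum (hZ.measurable 0) fun v => ENNReal.ofReal (Real.exp (t * v))]
  refine tsum_congr fun v => ?_
  have h := hZ.urnMean_eq 0 v
  simp only [Nat.cast_zero, zero_add, one_mul] at h
  rw [← h]
  simp [urnMean, urnConfig, ENNReal.ofReal_toReal (U₀.apply_ne_top v)]

/-- The mean configuration grows by the convolution of `p` with the law of `Z n`, and its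
exponential transform is `n + 1` times that of `Z n`. In `[0, ∞]` the sums can be exchanged freely.
-/
theorem IsUrnSelection.lintegral_exp_succ [IsProbabilityMeasure P] (hZ : IsUrnSelection P p U₀ Z)
    (t : ℝ) (n : ℕ) :
    (n + 2) * ∫⁻ ω, ENNReal.ofReal (Real.exp (t * Z (n + 1) ω)) ∂P =
      (n + 1 + p.emgf t) * ∫⁻ ω, ENNReal.ofReal (Real.exp (t * Z n ω)) ∂P := by
  set E : ℤ → ℝ≥0∞ := fun v => ENNReal.ofReal (Real.exp (t * v)) with hE
  have key : ∀ m : ℕ, ((m : ℝ≥0∞) + 1) * ∫⁻ ω, E (Z m ω) ∂P = ∑' v, E v * urnMean P p U₀ Z m v := by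
    intro m
    rw [lintegral_comp_eq_tsum (hZ.measurable m) E, ← ENNReal.tsum_mul_left]
    exact tsum_congr fun v => by rw [hZ.urnMean_eq]; ring
  have h1 := key (n + 1)
  have h2 : ∑' v, E v * ∑' u, p (v - u) * P {ω | Z n ω = u} =
      p.emgf t * ∫⁻ ω, E (Z n ω) ∂P := by
    rw [lintegral_comp_eq_tsum (hZ.measurable n) E, ← ENNReal.tsum_mul_left]
    simp_rw [← ENNReal.tsum_mul_left]
    rw [ENNReal.tsum_comm]
    refine tsum_congr fun u => ?_
    rw [PMF.emgf, ← ENNReal.tsum_mul_right, 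
      ← (Equiv.subRight u).tsum_eq (fun v => ENNReal.ofReal (Real.exp (t * v)) * p v * _)]
    refine tsum_congr fun v => ?_
    have : E v = E (v - u) * E u := by
      simp only [hE]
      rw [← ENNReal.ofReal_mul (Real.exp_pos _).le, ← Real.exp_add]
      congr 2; push_cast; ring
    rw [this]
    simp only [hE, Equiv.subRight_apply]
    ring
  simp_rw [urnMean_succ p U₀ hZ.measurable, mul_add] at h1
  rw [ENNReal.tsum_add, ← key n, h2, ← add_mul] at h1
  rw [← h1]
  push_cast
  congr 1
  rw [add_assoc]; norm_num

theorem PMF.emgf_eq_ofReal_sum {S : Finset ℤ} (hS : p.support ⊆ S) (t : ℝ) :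
    p.emgf t = ENNReal.ofReal (∑ u ∈ S, (p u).toReal * Real.exp (t * u)) := by
  rw [PMF.emgf, tsum_eq_sum (s := S), ENNReal.ofReal_sum_of_nonneg fun u _ => by positivity]
  · refine Finset.sum_congr rfl fun u _ => ?_
    rw [ENNReal.ofReal_mul ENNReal.toReal_nonneg, ENNReal.ofReal_toReal (p.apply_ne_top _), mul_comm]
  · intro u hu
    rw [(p.apply_eq_zero_iff u).mpr fun h => hu (hS h), mul_zero]

theorem IsUrnSelection.lintegral_exp [IsProbabilityMeasure P] (hZ : IsUrnSelection P p U₀ Z)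
    {S T : Finset ℤ} (hS : p.support ⊆ S) (hT : U₀.support ⊆ T) (t : ℝ) (n : ℕ) :
    ∫⁻ ω, ENNReal.ofReal (Real.exp (t * Z n ω)) ∂P =
      ENNReal.ofReal ((∑ v ∈ T, (U₀ v).toReal * Real.exp (t * v)) *
        ∏ k ∈ Finset.range n,
          (k + 1 + ∑ u ∈ S, (p u).toReal * Real.exp (t * u)) / ((k : ℝ) + 2)) := by
  have he : 0 ≤ ∑ u ∈ S, (p u).toReal * Real.exp (t * u) :=
    Finset.sum_nonneg fun u _ => by positivity
  have hφ : 0 ≤ ∑ v ∈ T, (U₀ v).toReal * Real.exp (t * v) :=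
    Finset.sum_nonneg fun u _ => by positivity
  induction n with
  | zero => simp [hZ.lintegral_exp_zero, PMF.emgf_eq_ofReal_sum hT]
  | succ n ih =>
    have h := hZ.lintegral_exp_succ t n
    rw [ih, PMF.emgf_eq_ofReal_sum hS] at h
    have h2 : ((n : ℝ≥0∞) + 2) = ENNReal.ofReal (n + 2) := by
      rw [ENNReal.ofReal_add (by positivity) (by positivity)]; simp
    have h1 : ((n : ℝ≥0∞) + 1) = ENNReal.ofReal (n + 1) := by
      rw [ENNReal.ofReal_add (by positivity) (by positivity)]; simp
    rw [h1, h2, ← ENNReal.ofReal_add (by positivity) he, ← ENNReal.ofReal_mul (by positivity)] at h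
    have h3 : ENNReal.ofReal ((n : ℝ) + 2) ≠ 0 := by
      rw [Ne, ENNReal.ofReal_eq_zero, not_le]; positivity
    refine (ENNReal.mul_right_inj h3 ENNReal.ofReal_ne_top).mp ?_
    rw [h, ← ENNReal.ofReal_mul (by positivity), Finset.prod_range_succ]
    congr 1
    field_simp

theorem IsUrnSelection.integrable_exp [IsProbabilityMeasure P] (hZ : IsUrnSelection P p U₀ Z)
    {S T : Finset ℤ} (hS : p.support ⊆ S) (hT : U₀.support ⊆ T) (t : ℝ) (n : ℕ) :
    Integrable (fun ω => Real.exp (t * Z n ω)) P := by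
  have hm : Measurable fun ω => Real.exp (t * Z n ω) :=
    (measurable_of_countable fun v : ℤ => Real.exp (t * v)).comp (hZ.measurable n)
  refine (lintegral_ofReal_ne_top_iff_integrable hm.aestronglyMeasurable
    (ae_of_all _ fun ω => (Real.exp_pos _).le)).mp ?_
  rw [hZ.lintegral_exp hS hT]
  exact ENNReal.ofReal_ne_top

theorem IsUrnSelection.mgf_eq [IsProbabilityMeasure P] (hZ : IsUrnSelection P p U₀ Z)
    {S T : Finset ℤ} (hS : p.support ⊆ S) (hT : U₀.support ⊆ T) (t : ℝ) (n : ℕ) :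
    mgf (fun ω => (Z n ω : ℝ)) P t = (∑ v ∈ T, (U₀ v).toReal * Real.exp (t * v)) *
        ∏ k ∈ Finset.range n,
          (k + 1 + ∑ u ∈ S, (p u).toReal * Real.exp (t * u)) / ((k : ℝ) + 2) := by
  rw [mgf, integral_eq_lintegral_of_nonneg_ae (ae_of_all _ fun ω => (Real.exp_pos _).le)
    (hZ.integrable_exp hS hT t n).aestronglyMeasurable, hZ.lintegral_exp hS hT,
    ENNReal.toReal_ofReal]
  exact mul_nonneg (Finset.sum_nonneg fun u _ => by positivity)
    (Finset.prod_nonneg fun k _ => div_nonneg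
      (add_nonneg (by positivity) (Finset.sum_nonneg fun u _ => by positivity)) (by positivity))

theorem PMF.integral_eq_sum_of_support_subset {S : Finset ℤ} (hS : p.support ⊆ S) (f : ℤ → ℝ) :
    ∫ u, f u ∂p.toMeasure = ∑ u ∈ S, (p u).toReal * f u := by
  have hf : Integrable f p.toMeasure := by
    refine (Integrable.of_bound (C := ∑ u ∈ S, |f u|)
      (measurable_of_countable f).aestronglyMeasurable ?_)
    rw [ae_iff, PMF.toMeasure_apply_eq_zero_iff p (Set.to_countable _).measurableSet]
    refine Set.disjoint_left.mpr fun u hu h => h ?_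
    exact Finset.single_le_sum (f := fun u => |f u|) (fun u _ => abs_nonneg _) (hS hu)
  rw [PMF.integral_eq_tsum p f hf, tsum_eq_sum (s := S)]
  · rfl
  · intro u hu
    rw [(p.apply_eq_zero_iff u).mpr fun h => hu (hS h)]; simp

end Urn

/-! ### Polynomial growth and logarithmic limits -/

section Growth

theorem tendsto_log_natCast_atTop : Tendsto (fun n : ℕ => Real.log n) atTop atTop :=
  Real.tendsto_log_atTop.comp tendsto_natCast_atTop_atTop

theorem tendsto_log_natCast_add_div_log {b : ℝ} (hb : 0 ≤ b) :
    Tendsto (fun n : ℕ => Real.log (n + b) / Real.log n) atTop (𝓝 1) := by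
  have h1 : Tendsto (fun n : ℕ => 1 + b / (n : ℝ)) atTop (𝓝 1) := by
    simpa using (tendsto_const_div_atTop_nhds_zero_nat b).const_add 1
  have h2 := (h1.log one_ne_zero).div_atTop tendsto_log_natCast_atTop
  have h3 := h2.const_add 1
  rw [add_zero] at h3
  refine h3.congr' ?_
  filter_upwards [tendsto_log_natCast_atTop.eventually_gt_atTop 0, eventually_gt_atTop 0]
    with n hn hn0
  have hn0' : (0 : ℝ) < n := by exact_mod_cast hn0
  have : (n : ℝ) + b = n * (1 + b / n) := by field_simp
  rw [this, Real.log_mul hn0'.ne' (by positivity)]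
  field_simp

/-- The product is a Gamma quotient: up to a factor tending to `Γ(a + 1)` it equals `n ^ (a + 1) /
((n + 1) (n + a + 1))`, whose exponent is `(a + 1) - 2`. -/
theorem tendsto_log_prod_div_log {a : ℝ} (ha : 0 ≤ a) :
    Tendsto (fun n : ℕ => Real.log (∏ k ∈ Finset.range n, (k + 1 + a) / ((k : ℝ) + 2)) /
      Real.log n) atTop (𝓝 (a - 1)) := by
  have hG : Tendsto (fun n => Real.log (Real.GammaSeq (a + 1) n) / Real.log n) atTop (𝓝 0) :=
    ((Real.GammaSeq_tendsto_Gamma (a + 1)).log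
      (Real.Gamma_pos_of_pos (by positivity)).ne').div_atTop tendsto_log_natCast_atTop
  have h := ((tendsto_const_nhds (x := a + 1)).sub
    (tendsto_log_natCast_add_div_log zero_le_one)).sub
    (tendsto_log_natCast_add_div_log (b := a + 1) (by positivity)) |>.sub hG
  rw [show a + 1 - 1 - 1 - 0 = a - 1 by ring] at h
  refine h.congr' ?_
  filter_upwards [tendsto_log_natCast_atTop.eventually_gt_atTop 0, eventually_gt_atTop 0]
    with n hn hn0
  have hn0' : (0 : ℝ) < n := by exact_mod_cast hn0
  have hprod : ∀ m : ℕ, 0 < ∏ j ∈ Finset.range m, (a + 1 + (j : ℝ)) := fun m =>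
    Finset.prod_pos fun j _ => by positivity
  have hGpos : 0 < Real.GammaSeq (a + 1) n := by
    have := hprod (n + 1)
    unfold Real.GammaSeq
    positivity
  have hfac : ∏ k ∈ Finset.range n, ((k : ℝ) + 2) = (n + 1) * (n.factorial : ℝ) := by
    have h0 : ∀ m : ℕ, ∏ k ∈ Finset.range m, ((k : ℝ) + 2) = (m + 1) * (m.factorial : ℝ) := by
      intro m
      induction m with
      | zero => simp
      | succ m ih => rw [Finset.prod_range_succ, ih, Nat.factorial_succ]; push_cast; ring
    exact h0 n
  have hP : (0 : ℝ) < ∏ k ∈ Finset.range n, (k + 1 + a) / ((k : ℝ) + 2) :=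
    Finset.prod_pos fun j _ => by positivity
  have key : (∏ k ∈ Finset.range n, (k + 1 + a) / ((k : ℝ) + 2)) *
      ((n + 1) * (n + (a + 1)) * Real.GammaSeq (a + 1) n) = (n : ℝ) ^ (a + 1) := by
    rw [Finset.prod_div_distrib, hfac, Real.GammaSeq, Finset.prod_range_succ]
    have e1 : ∏ k ∈ Finset.range n, ((k : ℝ) + 1 + a) = ∏ k ∈ Finset.range n, (a + 1 + (k : ℝ)) :=
      Finset.prod_congr rfl fun k _ => by ring
    have h1 := (hprod n).ne'
    have h2 : (n.factorial : ℝ) ≠ 0 := by positivity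
    have h3 : a + 1 + (n : ℝ) ≠ 0 := by positivity
    rw [e1]
    field_simp
    ring
  have hlog := congrArg Real.log key
  rw [Real.log_rpow hn0', Real.log_mul hP.ne' (by positivity), Real.log_mul (by positivity) hGpos.ne',
    Real.log_mul (by positivity) (by positivity)] at hlog
  rw [eq_div_iff hn.ne']
  field_simp
  linarith

/-- Two-sided bounds by powers of `n`, from the limit of `log x n / log n`. -/
theorem eventually_exp_bounds {x : ℕ → ℝ} (hx : ∀ n, 0 < x n) {c : ℝ}
    (h : Tendsto (fun n : ℕ => Real.log (x n) / Real.log n) atTop (𝓝 c)) {η : ℝ} (hη : 0 < η) :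
    ∀ᶠ n : ℕ in atTop, Real.exp (Real.log n * (c - η)) ≤ x n ∧
      x n ≤ Real.exp (Real.log n * (c + η)) := by
  filter_upwards [tendsto_log_natCast_atTop.eventually_gt_atTop 0,
    h.eventually (Ioo_mem_nhds (sub_lt_self c hη) (lt_add_of_pos_right c hη))] with n hn ⟨h1, h2⟩
  rw [lt_div_iff₀ hn] at h1
  rw [div_lt_iff₀ hn] at h2
  rw [← Real.le_log_iff_exp_le (hx n), ← Real.log_le_iff_le_exp (hx n)]
  constructor <;> linarith

/-- The lower bound also forces `x n` to be eventually positive and finite, so that the extended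
logarithm is the real one. -/
theorem tendsto_ereal_log_of_bounds {x : ℕ → ℝ≥0∞} {c : ℝ}
    (hl : ∀ η > 0, ∀ᶠ n : ℕ in atTop, Real.exp (Real.log n * (c - η)) ≤ (x n).toReal)
    (hu : ∀ η > 0, ∀ᶠ n : ℕ in atTop, (x n).toReal ≤ Real.exp (Real.log n * (c + η))) :
    Tendsto (fun n : ℕ => ((1 / Real.log n : ℝ) : EReal) * ENNReal.log (x n)) atTop
      (𝓝 (c : EReal)) := by
  have h : Tendsto (fun n : ℕ => 1 / Real.log n * Real.log (x n).toReal) atTop (𝓝 c) := by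
    rw [Metric.tendsto_nhds]
    intro η hη
    filter_upwards [hl (η / 2) (by positivity), hu (η / 2) (by positivity),
      tendsto_log_natCast_atTop.eventually_gt_atTop 0] with n h1 h2 hn
    have hpos := (Real.exp_pos _).trans_le h1
    rw [← Real.le_log_iff_exp_le hpos] at h1
    rw [← Real.log_le_iff_le_exp hpos] at h2
    rw [Real.dist_eq, one_div_mul_eq_div]
    refine lt_of_le_of_lt (abs_sub_le_iff.mpr ⟨?_, ?_⟩) (half_lt_self hη)
    · rw [sub_le_iff_le_add, div_le_iff₀ hn]; linarith
    · rw [sub_le_comm, le_div_iff₀ hn]; linarith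
  refine (EReal.tendsto_coe.mpr h).congr' ?_
  filter_upwards [hl 1 one_pos] with n h1
  have hpos := (Real.exp_pos _).trans_le h1
  rw [EReal.coe_mul, ENNReal.log_pos_real' hpos]

theorem tendsto_ereal_log_of_eventually_zero {x : ℕ → ℝ≥0∞} (hx : ∀ᶠ n in atTop, x n = 0) :
    Tendsto (fun n : ℕ => ((1 / Real.log n : ℝ) : EReal) * ENNReal.log (x n)) atTop (𝓝 ⊥) := by
  refine tendsto_const_nhds.congr' ?_
  filter_upwards [hx, tendsto_log_natCast_atTop.eventually_gt_atTop 0] with n h hn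
  rw [h, ENNReal.log_zero, EReal.coe_mul_bot_of_pos (by positivity)]

theorem eventually_le_exp_log_mul {η : ℝ} (hη : 0 < η) (C : ℝ) :
    ∀ᶠ n : ℕ in atTop, C ≤ Real.exp (Real.log n * η) :=
  (Real.tendsto_exp_atTop.comp
    (tendsto_log_natCast_atTop.atTop_mul_const hη)).eventually_ge_atTop C

end Growth

/-! ### Convexity and slopes of the Laplace transform -/

section ExpSum

variable {S : Finset ℤ} {q : ℤ → ℝ} {ξ : ℤ → ℤ}

/-- The Laplace transform of the image under `ξ` of the weights `q` on `S`. -/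
noncomputable def expSum (S : Finset ℤ) (q : ℤ → ℝ) (ξ : ℤ → ℤ) (t : ℝ) : ℝ :=
  ∑ i ∈ S, q i * Real.exp (t * ξ i)

/-- The derivative of `expSum`. -/
noncomputable def expSumDeriv (S : Finset ℤ) (q : ℤ → ℝ) (ξ : ℤ → ℤ) (t : ℝ) : ℝ :=
  ∑ i ∈ S, q i * (ξ i * Real.exp (t * ξ i))

theorem hasDerivAt_expSum (t : ℝ) : HasDerivAt (expSum S q ξ) (expSumDeriv S q ξ t) t := by
  unfold expSum expSumDeriv
  refine HasDerivAt.fun_sum fun i _ => HasDerivAt.const_mul _ ?_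
  simpa [mul_comm] using ((hasDerivAt_id t).mul_const (ξ i : ℝ)).exp

theorem continuous_expSum : Continuous (expSum S q ξ) := by
  unfold expSum; fun_prop

theorem continuous_expSumDeriv : Continuous (expSumDeriv S q ξ) := by
  unfold expSumDeriv; fun_prop

theorem expSum_nonneg (hq : ∀ i ∈ S, 0 < q i) (t : ℝ) : 0 ≤ expSum S q ξ t :=
  Finset.sum_nonneg fun i hi => mul_nonneg (hq i hi).le (Real.exp_pos _).le

theorem expSum_pos (hS : S.Nonempty) (hq : ∀ i ∈ S, 0 < q i) (t : ℝ) : 0 < expSum S q ξ t :=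
  Finset.sum_pos (fun i hi => mul_pos (hq i hi) (Real.exp_pos _)) hS

/-- Convexity, termwise from `1 + z ≤ exp z`. This identifies the maximizer in the Legendre
transform. -/
theorem expSum_tangent (hq : ∀ i ∈ S, 0 < q i) (s t : ℝ) :
    expSum S q ξ s + expSumDeriv S q ξ s * (t - s) ≤ expSum S q ξ t := by
  unfold expSum expSumDeriv
  rw [Finset.sum_mul, ← Finset.sum_add_distrib]
  refine Finset.sum_le_sum fun i hi => ?_
  have h1 := Real.add_one_le_exp ((t - s) * ξ i)
  have h2 : Real.exp (t * ξ i) = Real.exp (s * ξ i) * Real.exp ((t - s) * ξ i) := by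
    rw [← Real.exp_add]; congr 1; ring
  have h3 := mul_le_mul_of_nonneg_left h1 (mul_pos (hq i hi) (Real.exp_pos (s * ξ i))).le
  rw [h2]
  linarith

theorem mul_exp_mono (u : ℤ) : Monotone fun t : ℝ => (u : ℝ) * Real.exp (t * u) := by
  intro s t h
  rcases le_total 0 (u : ℝ) with hu | hu
  · exact mul_le_mul_of_nonneg_left (Real.exp_le_exp.mpr (mul_le_mul_of_nonneg_right h hu)) hu
  · exact mul_le_mul_of_nonpos_left (Real.exp_le_exp.mpr (mul_le_mul_of_nonpos_right h hu)) hu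

theorem mul_exp_strictMono {u : ℤ} (hu : u ≠ 0) :
    StrictMono fun t : ℝ => (u : ℝ) * Real.exp (t * u) := by
  intro s t h
  rcases lt_or_gt_of_ne hu with hu | hu
  · have hu : (u : ℝ) < 0 := by exact_mod_cast hu
    exact mul_lt_mul_of_neg_left (Real.exp_lt_exp.mpr (mul_lt_mul_of_neg_right h hu)) hu
  · have hu : 0 < (u : ℝ) := by exact_mod_cast hu
    exact mul_lt_mul_of_pos_left (Real.exp_lt_exp.mpr (mul_lt_mul_of_pos_right h hu)) hu

theorem expSumDeriv_strictMono (hq : ∀ i ∈ S, 0 < q i) (h : ∃ i ∈ S, ξ i ≠ 0) :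
    StrictMono (expSumDeriv S q ξ) := by
  intro s t hst
  obtain ⟨i, hi, hξ⟩ := h
  exact Finset.sum_lt_sum
    (fun j hj => mul_le_mul_of_nonneg_left (mul_exp_mono (ξ j) hst.le) (hq j hj).le)
    ⟨i, hi, mul_lt_mul_of_pos_left (mul_exp_strictMono hξ hst) (hq i hi)⟩

theorem exists_lt_expSumDeriv_of_pos (hq : ∀ i ∈ S, 0 < q i) {i : ℤ} (hi : i ∈ S) (hξ : 0 < ξ i)
    (x : ℝ) : ∃ t, 0 ≤ t ∧ x < expSumDeriv S q ξ t := by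
  have hξ' : (1 : ℝ) ≤ ξ i := by exact_mod_cast hξ
  -- The single term with `ξ i ≥ 1` already makes the slope grow at least linearly, at rate `q i`,
  -- since no other term decreases.
  have h : Tendsto (fun t : ℝ => expSumDeriv S q ξ 0 + q i * t) atTop atTop :=
    tendsto_atTop_add_const_left _ _ (tendsto_id.const_mul_atTop (hq i hi))
  obtain ⟨t, ht, ht0⟩ := ((h.eventually_gt_atTop x).and (eventually_ge_atTop 0)).exists
  refine ⟨t, ht0, ht.trans_le ?_⟩
  rw [← le_sub_iff_add_le', expSumDeriv, expSumDeriv, ← Finset.sum_sub_distrib]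
  have hnn : ∀ j ∈ S, 0 ≤ q j * (ξ j * Real.exp (t * ξ j)) - q j * (ξ j * Real.exp (0 * ξ j)) :=
    fun j hj => sub_nonneg.mpr (mul_le_mul_of_nonneg_left (mul_exp_mono (ξ j) ht0) (hq j hj).le)
  refine le_trans ?_ (Finset.single_le_sum hnn hi)
  rw [← mul_sub, ← mul_sub, zero_mul, Real.exp_zero]
  refine mul_le_mul_of_nonneg_left ?_ (hq i hi).le
  have h1 := Real.add_one_le_exp (t * ξ i)
  have h2 : t ≤ t * ξ i := le_mul_of_one_le_right ht0 hξ'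
  have h3 : 0 ≤ Real.exp (t * ξ i) - 1 := by linarith
  nlinarith [mul_le_mul_of_nonneg_right hξ' h3]

theorem tendsto_exp_mul_atTop_of_neg {u : ℝ} (hu : u < 0) :
    Tendsto (fun t : ℝ => Real.exp (t * u)) atTop (𝓝 0) :=
  Real.tendsto_exp_atBot.comp (tendsto_id.atTop_mul_const_of_neg hu)

theorem tendsto_expSumDeriv_of_nonpos (hξ : ∀ i ∈ S, ξ i ≤ 0) :
    Tendsto (expSumDeriv S q ξ) atTop (𝓝 0) := by
  rw [← Finset.sum_const_zero (s := S)]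
  refine tendsto_finsetSum S fun i hi => ?_
  rcases (hξ i hi).eq_or_lt with h | h
  · simp [h]
  · have h' : (ξ i : ℝ) < 0 := by exact_mod_cast h
    simpa using ((tendsto_exp_mul_atTop_of_neg h').const_mul (ξ i : ℝ)).const_mul (q i)

theorem tendsto_expSum_of_nonpos (hξ : ∀ i ∈ S, ξ i ≤ 0) :
    Tendsto (expSum S q ξ) atTop (𝓝 (∑ i ∈ S with ξ i = 0, q i)) := by
  rw [Finset.sum_filter]
  refine tendsto_finsetSum S fun i hi => ?_
  rcases (hξ i hi).eq_or_lt with h | h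
  · simp [h]
  · have h' : (ξ i : ℝ) < 0 := by exact_mod_cast h
    simpa [h.ne] using (tendsto_exp_mul_atTop_of_neg h').const_mul (q i)

theorem sum_filter_le_expSum (hq : ∀ i ∈ S, 0 < q i) (t : ℝ) :
    ∑ i ∈ S with ξ i = 0, q i ≤ expSum S q ξ t := by
  rw [Finset.sum_filter]
  refine Finset.sum_le_sum fun i hi => ?_
  split_ifs with h
  · simp [h]
  · exact (mul_pos (hq i hi) (Real.exp_pos _)).le

/-- Above its mean, the value `x` is a slope of the Laplace transform unless the law lives on the
nonpositive integers and `x` is nonnegative. -/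
theorem exists_expSumDeriv_eq (hq : ∀ i ∈ S, 0 < q i) {x : ℝ} (hx : expSumDeriv S q ξ 0 < x)
    (h : (∃ i ∈ S, 0 < ξ i) ∨ ((∀ i ∈ S, ξ i ≤ 0) ∧ x < 0)) :
    ∃ t, 0 < t ∧ expSumDeriv S q ξ t = x := by
  obtain ⟨t, ht0, ht⟩ : ∃ t, 0 ≤ t ∧ x < expSumDeriv S q ξ t := by
    rcases h with ⟨i, hi, hξ⟩ | ⟨hξ, hx0⟩
    · exact exists_lt_expSumDeriv_of_pos hq hi hξ x
    · obtain ⟨t, h1, h2⟩ := (((tendsto_expSumDeriv_of_nonpos hξ).eventually_const_lt hx0).and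
        (eventually_ge_atTop 0)).exists
      exact ⟨t, h2, h1⟩
  obtain ⟨s, ⟨hs0, -⟩, hs⟩ := intermediate_value_Icc ht0
    continuous_expSumDeriv.continuousOn ⟨hx.le, ht.le⟩
  refine ⟨s, lt_of_le_of_ne hs0 ?_, hs⟩
  rintro rfl
  exact hx.ne hs

end ExpSum

/-! ### Tail asymptotics from the moment generating function -/

section Tail

variable {Ω : Type*} {mΩ : MeasurableSpace Ω}

/-- Integer-valued random variables `Y n` whose moment generating functions are those of the
selected colours of an urn: `q` and `a` are the weights of the step law and of the initial
configuration, on the images under `ξ` of `S` and `T`. -/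
structure HasUrnMGF (P : Measure Ω) (Y : ℕ → Ω → ℤ) (S T : Finset ℤ) (q a : ℤ → ℝ)
    (ξ : ℤ → ℤ) : Prop where
  step_pos : ∀ i ∈ S, 0 < q i
  init_pos : ∀ i ∈ T, 0 < a i
  init_nonempty : T.Nonempty
  measurable : ∀ n, Measurable (Y n)
  integrable : ∀ n t, Integrable (fun ω => Real.exp (t * Y n ω)) P
  mgf_eq : ∀ n t, mgf (fun ω => (Y n ω : ℝ)) P t =
    expSum T a ξ t * ∏ k ∈ Finset.range n, (k + 1 + expSum S q ξ t) / ((k : ℝ) + 2)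

namespace HasUrnMGF

variable {P : Measure Ω} {Y : ℕ → Ω → ℤ} {S T : Finset ℤ} {q a : ℤ → ℝ} {ξ : ℤ → ℤ} {x : ℝ}

theorem prod_pos {b : ℝ} (hb : 0 ≤ b) (n : ℕ) :
    0 < ∏ k ∈ Finset.range n, (k + 1 + b) / ((k : ℝ) + 2) :=
  Finset.prod_pos fun k _ => by positivity

/-- The initial factor does not depend on `n`, so only the product contributes to the exponent. -/
theorem eventually_mgf (h : HasUrnMGF P Y S T q a ξ) (t : ℝ) {η : ℝ} (hη : 0 < η) :
    ∀ᶠ n : ℕ in atTop,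
      Real.exp (Real.log n * (expSum S q ξ t - 1 - η)) ≤ mgf (fun ω => (Y n ω : ℝ)) P t ∧
      mgf (fun ω => (Y n ω : ℝ)) P t ≤ Real.exp (Real.log n * (expSum S q ξ t - 1 + η)) := by
  have he := expSum_nonneg (ξ := ξ) h.step_pos t
  have hφ := expSum_pos (ξ := ξ) h.init_nonempty h.init_pos t
  refine eventually_exp_bounds (fun n => ?_) ?_ hη
  · rw [h.mgf_eq]
    exact mul_pos hφ (prod_pos he n)
  · have h1 := ((tendsto_const_nhds (x := Real.log (expSum T a ξ t))).div_atTop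
      tendsto_log_natCast_atTop).add (tendsto_log_prod_div_log he)
    rw [zero_add] at h1
    refine h1.congr fun n => ?_
    rw [h.mgf_eq, Real.log_mul hφ.ne' (prod_pos he n).ne', add_div]

theorem setOf_le_div_log {n : ℕ} (hn : 0 < Real.log n) :
    {ω | x ≤ (Y n ω : ℝ) / Real.log n} = {ω | x * Real.log n ≤ (Y n ω : ℝ)} := by
  ext ω
  exact le_div_iff₀ hn

/-- The reflection that reduces left tails to right tails; `ξ` is a parameter of the structure for
its sake. -/
theorem neg (h : HasUrnMGF P Y S T q a ξ) :
    HasUrnMGF P (fun n ω => -Y n ω) S T q a (fun i => -ξ i) where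
  step_pos := h.step_pos
  init_pos := h.init_pos
  init_nonempty := h.init_nonempty
  measurable n := (h.measurable n).neg
  integrable n t := by simpa using h.integrable n (-t)
  mgf_eq n t := by
    have := h.mgf_eq n (-t)
    simpa [expSum, mgf] using this

variable [IsProbabilityMeasure P]

/-- Chernoff's inequality at level `x log n`. -/
theorem eventually_tail_le (h : HasUrnMGF P Y S T q a ξ) {t : ℝ} (ht : 0 ≤ t) {η : ℝ}
    (hη : 0 < η) : ∀ᶠ n : ℕ in atTop, P.real {ω | x ≤ (Y n ω : ℝ) / Real.log n} ≤
      Real.exp (Real.log n * (expSum S q ξ t - 1 - x * t + η)) := by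
  filter_upwards [h.eventually_mgf t hη, tendsto_log_natCast_atTop.eventually_gt_atTop 0]
    with n hn hL
  rw [setOf_le_div_log hL]
  refine (measure_ge_le_exp_mul_mgf _ ht (h.integrable n t)).trans ?_
  refine (mul_le_mul_of_nonneg_left hn.2 (Real.exp_pos _).le).trans ?_
  rw [← Real.exp_add]
  refine Real.exp_le_exp.mpr (le_of_eq ?_)
  ring

/-- Holds pointwise: below `b` the tilt by `-s` dominates `exp (t Y)`, above `c` the tilt by `+s`
does, and in between `exp (t Y) ≤ exp (t c)`. -/
theorem mgf_le_of_truncation (h : HasUrnMGF P Y S T q a ξ) {s t b c : ℝ} (hs : 0 ≤ s) (ht : 0 ≤ t)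
    (n : ℕ) :
    mgf (fun ω => (Y n ω : ℝ)) P t ≤
      Real.exp (-s * c) * mgf (fun ω => (Y n ω : ℝ)) P (t + s) +
      Real.exp (s * b) * mgf (fun ω => (Y n ω : ℝ)) P (t - s) +
      Real.exp (t * c) * P.real {ω | b ≤ (Y n ω : ℝ)} := by
  have hms : MeasurableSet {ω | b ≤ (Y n ω : ℝ)} :=
    (h.measurable n) (Set.to_countable {v : ℤ | b ≤ (v : ℝ)}).measurableSet
  have i1 := (h.integrable n (t + s)).const_mul (Real.exp (-s * c))
  have i2 := (h.integrable n (t - s)).const_mul (Real.exp (s * b))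
  have i12 : Integrable (fun ω => Real.exp (-s * c) * Real.exp ((t + s) * Y n ω) +
      Real.exp (s * b) * Real.exp ((t - s) * Y n ω)) P := i1.add i2
  have i3 : Integrable (fun ω => Real.exp (t * c) *
      Set.indicator {ω | b ≤ (Y n ω : ℝ)} (fun _ => (1 : ℝ)) ω) P :=
    ((integrable_const 1).indicator hms).const_mul _
  have e3 : ∫ ω, Set.indicator {ω | b ≤ (Y n ω : ℝ)} (fun _ => (1 : ℝ)) ω ∂P =
      P.real {ω | b ≤ (Y n ω : ℝ)} := by
    rw [integral_indicator_const _ hms]; simp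
  simp only [mgf]
  rw [← e3, ← integral_const_mul, ← integral_const_mul, ← integral_const_mul,
    ← integral_add i1 i2, ← integral_add i12 i3]
  refine integral_mono (h.integrable n t) (i12.add i3) fun ω => ?_
  simp only
  rw [← Real.exp_add, ← Real.exp_add]
  set y : ℝ := (Y n ω : ℝ)
  have hind : 0 ≤ Real.exp (t * c) * Set.indicator {ω | b ≤ (Y n ω : ℝ)} (fun _ => (1 : ℝ)) ω :=
    mul_nonneg (Real.exp_pos _).le (Set.indicator_nonneg (fun _ _ => zero_le_one) _)
  have p1 := (Real.exp_pos (-s * c + (t + s) * y)).le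
  have p2 := (Real.exp_pos (s * b + (t - s) * y)).le
  rcases lt_or_ge y b with hb | hb
  · have : t * y ≤ s * b + (t - s) * y := by nlinarith [mul_le_mul_of_nonneg_left hb.le hs]
    have := Real.exp_le_exp.mpr this
    linarith
  rcases lt_or_ge c y with hc | hc
  · have : t * y ≤ -s * c + (t + s) * y := by nlinarith [mul_le_mul_of_nonneg_left hc.le hs]
    have := Real.exp_le_exp.mpr this
    linarith
  · rw [Set.indicator_of_mem (show ω ∈ {ω | b ≤ (Y n ω : ℝ)} from hb), mul_one]
    have := Real.exp_le_exp.mpr (mul_le_mul_of_nonneg_left hc ht)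
    linarith

theorem exists_step (t : ℝ) {κ : ℝ} (hκ : 0 < κ) :
    ∃ s > 0, expSum S q ξ (t + s) ≤ expSum S q ξ t + s * (expSumDeriv S q ξ t + κ) ∧
      expSum S q ξ (t - s) ≤ expSum S q ξ t + s * (-expSumDeriv S q ξ t + κ) := by
  have hd := (hasDerivAt_iff_isLittleO_nhds_zero.mp
    (hasDerivAt_expSum (S := S) (q := q) (ξ := ξ) t)).def hκ
  obtain ⟨r, hr, hball⟩ := Metric.eventually_nhds_iff.mp hd
  refine ⟨r / 2, by positivity, ?_, ?_⟩
  · have := hball (y := r / 2) (by rw [Real.dist_eq, sub_zero, abs_of_pos] <;> linarith)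
    rw [Real.norm_eq_abs, Real.norm_eq_abs, abs_of_pos (half_pos hr), smul_eq_mul] at this
    linarith [le_abs_self (expSum S q ξ (t + r / 2) - expSum S q ξ t - r / 2 * expSumDeriv S q ξ t)]
  · have := hball (y := -(r / 2)) (by rw [Real.dist_eq, sub_zero, abs_neg, abs_of_pos] <;> linarith)
    rw [Real.norm_eq_abs, Real.norm_eq_abs, abs_neg, abs_of_pos (half_pos hr), smul_eq_mul,
      ← sub_eq_add_neg] at this
    linarith [le_abs_self
      (expSum S q ξ (t - r / 2) - expSum S q ξ t - -(r / 2) * expSumDeriv S q ξ t)]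

/-- Truncate to the window from `x log n` to `(2y - x) log n`, centred at `y log n` with `y` the
slope at `t`. The two outer terms are of smaller exponential order, so the window carries at least
half of the moment, at a cost of at most `exp (t (2y - x) log n)`. -/
theorem eventually_le_tail_of_lt (h : HasUrnMGF P Y S T q a ξ) {t : ℝ} (ht : 0 ≤ t)
    (hx : x < expSumDeriv S q ξ t) {η : ℝ} (hη : 0 < η) :
    ∀ᶠ n : ℕ in atTop,
      Real.exp (Real.log n * (expSum S q ξ t - 1 - t * (2 * expSumDeriv S q ξ t - x) - η)) ≤
        P.real {ω | x ≤ (Y n ω : ℝ) / Real.log n} := by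
  set y := expSumDeriv S q ξ t with hy
  set e := expSum S q ξ t with he
  obtain ⟨δ, hδ⟩ : ∃ δ, δ = y - x := ⟨_, rfl⟩
  have hδ0 : 0 < δ := by linarith
  obtain ⟨s, hs, hs1, hs2⟩ := exists_step (S := S) (q := q) (ξ := ξ) t (half_pos hδ0)
  rw [← hy, ← he] at hs1 hs2
  -- The outer exponents fall below `e - 1` by `s δ / 2 = 4κ`, minus one `κ` lost in the moment
  -- asymptotics. The resulting gap of `2κ` to the lower bound for `M` absorbs the factor `4`.
  set κ := s * δ / 8 with hκ
  have hκ0 : 0 < κ := by positivity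
  filter_upwards [h.eventually_mgf t hκ0, h.eventually_mgf t (half_pos hη),
    h.eventually_mgf (t + s) hκ0, h.eventually_mgf (t - s) hκ0,
    eventually_le_exp_log_mul (show 0 < 2 * κ by positivity) 4,
    eventually_le_exp_log_mul (half_pos hη) 2,
    tendsto_log_natCast_atTop.eventually_gt_atTop 0] with n m1 m2 m3 m4 g1 g2 hL
  rw [setOf_le_div_log hL]
  set ℓ := Real.log n
  have tr := h.mgf_le_of_truncation hs.le ht n (b := x * ℓ) (c := (y + δ) * ℓ)
  set p := P.real {ω | x * ℓ ≤ (Y n ω : ℝ)}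
  set M := mgf (fun ω => (Y n ω : ℝ)) P t
  have b1 : Real.exp (-s * ((y + δ) * ℓ)) * mgf (fun ω => (Y n ω : ℝ)) P (t + s) ≤
      Real.exp (ℓ * (e - 1 - 3 * κ)) := by
    refine (mul_le_mul_of_nonneg_left m3.2 (Real.exp_pos _).le).trans ?_
    rw [← Real.exp_add]
    refine Real.exp_le_exp.mpr ?_
    have := mul_le_mul_of_nonneg_left hs1 hL.le
    rw [hκ]
    linarith
  have b2 : Real.exp (s * (x * ℓ)) * mgf (fun ω => (Y n ω : ℝ)) P (t - s) ≤
      Real.exp (ℓ * (e - 1 - 3 * κ)) := by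
    refine (mul_le_mul_of_nonneg_left m4.2 (Real.exp_pos _).le).trans ?_
    rw [← Real.exp_add]
    refine Real.exp_le_exp.mpr ?_
    have := mul_le_mul_of_nonneg_left hs2 hL.le
    have hx' : x = y - δ := by linarith
    rw [hκ, hx']
    linarith
  have b3 : 4 * Real.exp (ℓ * (e - 1 - 3 * κ)) ≤ M := by
    refine le_trans ?_ m1.1
    rw [show ℓ * (e - 1 - κ) = ℓ * (2 * κ) + ℓ * (e - 1 - 3 * κ) by ring, Real.exp_add]
    exact mul_le_mul_of_nonneg_right g1 (Real.exp_pos _).le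
  have b4 : 2 * Real.exp (ℓ * (e - 1 - η)) ≤ M := by
    refine le_trans ?_ m2.1
    rw [show ℓ * (e - 1 - η / 2) = ℓ * (η / 2) + ℓ * (e - 1 - η) by ring, Real.exp_add]
    exact mul_le_mul_of_nonneg_right g2 (Real.exp_pos _).le
  have b5 : Real.exp (ℓ * (e - 1 - η)) ≤ Real.exp (t * ((y + δ) * ℓ)) * p := by linarith
  rw [show ℓ * (e - 1 - t * (2 * y - x) - η) = -(t * ((y + δ) * ℓ)) + ℓ * (e - 1 - η) by
    rw [hδ]; ring, Real.exp_add]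
  refine (mul_le_mul_of_nonneg_left b5 (Real.exp_pos _).le).trans (le_of_eq ?_)
  rw [← mul_assoc, ← Real.exp_add, neg_add_cancel, Real.exp_zero, one_mul]

/-- Use the preceding bound at `r > t`, where the slope strictly exceeds `x`, and let `r` decrease
to `t`: the exponent is continuous, and at `t` the window endpoint `2y - x` collapses to `x`. -/
theorem eventually_le_tail (h : HasUrnMGF P Y S T q a ξ) (hS : ∃ i ∈ S, ξ i ≠ 0) {t : ℝ}
    (ht : 0 < t) (hx : expSumDeriv S q ξ t = x) {η : ℝ} (hη : 0 < η) :
    ∀ᶠ n : ℕ in atTop, Real.exp (Real.log n * (expSum S q ξ t - 1 - x * t - η)) ≤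
        P.real {ω | x ≤ (Y n ω : ℝ) / Real.log n} := by
  have hc : ContinuousAt
      (fun r => expSum S q ξ r - 1 - r * (2 * expSumDeriv S q ξ r - x)) t := by
    have h1 := continuous_expSum (S := S) (q := q) (ξ := ξ)
    have h2 := continuous_expSumDeriv (S := S) (q := q) (ξ := ξ)
    fun_prop
  have hlt : expSum S q ξ t - 1 - x * t - η / 2 <
      expSum S q ξ t - 1 - t * (2 * expSumDeriv S q ξ t - x) := by
    rw [hx]; linarith
  obtain ⟨r, hr1, hr2⟩ := (((hc.eventually_const_lt hlt).filter_mono nhdsWithin_le_nhds).and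
    (self_mem_nhdsWithin (s := Set.Ioi t))).exists
  have hxr : x < expSumDeriv S q ξ r := hx ▸ expSumDeriv_strictMono h.step_pos hS hr2
  filter_upwards [h.eventually_le_tail_of_lt (ht.trans hr2).le hxr (half_pos hη),
    tendsto_log_natCast_atTop.eventually_gt_atTop 0] with n hn hL
  refine le_trans (Real.exp_le_exp.mpr (mul_le_mul_of_nonneg_left ?_ hL.le)) hn
  linarith

theorem tendsto_tail_of_slope (h : HasUrnMGF P Y S T q a ξ) (hS : ∃ i ∈ S, ξ i ≠ 0) {t : ℝ}
    (ht : 0 < t) (hx : expSumDeriv S q ξ t = x) :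
    Tendsto (fun n : ℕ => ((1 / Real.log n : ℝ) : EReal) *
        ENNReal.log (P {ω | x ≤ (Y n ω : ℝ) / Real.log n})) atTop
      (𝓝 (-⨆ r : ℝ, ((x * r - expSum S q ξ r + 1 : ℝ) : EReal))) := by
  have hsup : (⨆ r : ℝ, ((x * r - expSum S q ξ r + 1 : ℝ) : EReal)) =
      ((x * t - expSum S q ξ t + 1 : ℝ) : EReal) := by
    refine le_antisymm (iSup_le fun r => EReal.coe_le_coe_iff.mpr ?_)
      (le_iSup (fun r : ℝ => ((x * r - expSum S q ξ r + 1 : ℝ) : EReal)) t)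
    have := expSum_tangent (ξ := ξ) h.step_pos t r
    rw [hx] at this
    linarith
  rw [hsup, ← EReal.coe_neg, show -(x * t - expSum S q ξ t + 1) = expSum S q ξ t - 1 - x * t by ring]
  exact tendsto_ereal_log_of_bounds (fun η hη => h.eventually_le_tail hS ht hx hη)
    (fun η hη => h.eventually_tail_le ht.le hη)

/-! ### Boundary cases: nonpositive steps -/

theorem expSum_le_of_le (ha : ∀ i ∈ T, 0 < a i) {V : ℤ} (hV : ∀ i ∈ T, ξ i ≤ V) {t : ℝ}
    (ht : 0 ≤ t) : expSum T a ξ t ≤ (∑ i ∈ T, a i) * Real.exp (t * V) := by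
  rw [expSum, Finset.sum_mul]
  refine Finset.sum_le_sum fun i hi => mul_le_mul_of_nonneg_left (Real.exp_le_exp.mpr
    (mul_le_mul_of_nonneg_left ?_ ht)) (ha i hi).le
  exact_mod_cast hV i hi

theorem expSum_le_sum (hq : ∀ i ∈ S, 0 < q i) (hξ : ∀ i ∈ S, ξ i ≤ 0) {t : ℝ}
    (ht : 0 ≤ t) : expSum S q ξ t ≤ ∑ i ∈ S, q i := by
  simpa using expSum_le_of_le hq (V := 0) hξ ht

/-- Chernoff's bound with `t → ∞`: the moment is at most `C exp (t V)`, while integrality puts the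
threshold at `V + 1`, leaving `C exp (-t)`. -/
theorem measure_gt_eq_zero (h : HasUrnMGF P Y S T q a ξ) (hξ : ∀ i ∈ S, ξ i ≤ 0) {V : ℤ}
    (hV : ∀ i ∈ T, ξ i ≤ V) (n : ℕ) : P {ω | V < Y n ω} = 0 := by
  have hset : {ω | V < Y n ω} = {ω | ((V + 1 : ℤ) : ℝ) ≤ (Y n ω : ℝ)} := by
    ext ω
    simp only [Set.mem_ofPred_eq, Int.cast_le]
    exact Int.lt_iff_add_one_le
  rw [hset, ← measureReal_eq_zero_iff]
  refine le_antisymm ?_ measureReal_nonneg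
  obtain ⟨C, hC⟩ : ∃ C, C = (∑ i ∈ T, a i) *
    ∏ k ∈ Finset.range n, (k + 1 + ∑ i ∈ S, q i) / ((k : ℝ) + 2) := ⟨_, rfl⟩
  have hlim : Tendsto (fun t : ℝ => C * Real.exp (t * (-1))) atTop (𝓝 0) := by
    simpa using (tendsto_exp_mul_atTop_of_neg (u := -1) (by norm_num)).const_mul C
  refine ge_of_tendsto hlim ?_
  filter_upwards [eventually_ge_atTop 0] with t ht
  refine (measure_ge_le_exp_mul_mgf _ ht (h.integrable n t)).trans ?_
  have h1 := expSum_le_of_le h.init_pos hV ht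
  have h2 : ∏ k ∈ Finset.range n, (k + 1 + expSum S q ξ t) / ((k : ℝ) + 2) ≤
      ∏ k ∈ Finset.range n, (k + 1 + ∑ i ∈ S, q i) / ((k : ℝ) + 2) := by
    have h0 := expSum_nonneg (ξ := ξ) h.step_pos t
    refine Finset.prod_le_prod (fun k _ => by positivity) fun k _ => ?_
    have := expSum_le_sum h.step_pos hξ ht
    gcongr
  have h3 : mgf (fun ω => (Y n ω : ℝ)) P t ≤ C * Real.exp (t * V) := by
    rw [h.mgf_eq, hC, mul_right_comm]
    exact mul_le_mul h1 h2 (prod_pos (expSum_nonneg h.step_pos t) n).le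
      ((expSum_nonneg h.init_pos t).trans h1)
  refine (mul_le_mul_of_nonneg_left h3 (Real.exp_pos _).le).trans (le_of_eq ?_)
  rw [mul_left_comm, ← Real.exp_add]
  congr 2
  push_cast
  ring

/-- Both sides are `-∞`: the transform is bounded for `r ≥ 0`, and `x log n` eventually exceeds
every initial colour. -/
theorem tendsto_tail_of_nonpos_of_pos (h : HasUrnMGF P Y S T q a ξ) (hξ : ∀ i ∈ S, ξ i ≤ 0)
    (hx : 0 < x) :
    Tendsto (fun n : ℕ => ((1 / Real.log n : ℝ) : EReal) *
        ENNReal.log (P {ω | x ≤ (Y n ω : ℝ) / Real.log n})) atTop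
      (𝓝 (-⨆ r : ℝ, ((x * r - expSum S q ξ r + 1 : ℝ) : EReal))) := by
  have hsup : (⨆ r : ℝ, ((x * r - expSum S q ξ r + 1 : ℝ) : EReal)) = ⊤ := by
    rw [EReal.eq_top_iff_forall_lt]
    intro y
    obtain ⟨r, hr, hr0⟩ := (((tendsto_id.const_mul_atTop hx).eventually_gt_atTop
      (y + ∑ i ∈ S, q i)).and (eventually_ge_atTop 0)).exists
    refine lt_of_lt_of_le (EReal.coe_lt_coe_iff.mpr ?_)
      (le_iSup (fun r : ℝ => ((x * r - expSum S q ξ r + 1 : ℝ) : EReal)) r)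
    have := expSum_le_sum h.step_pos hξ hr0
    simp only [id] at hr
    linarith
  rw [hsup, EReal.neg_top]
  refine tendsto_ereal_log_of_eventually_zero ?_
  obtain ⟨V, hV⟩ : ∃ V : ℤ, ∀ i ∈ T, ξ i ≤ V :=
    ⟨T.sup' h.init_nonempty ξ, fun i hi => Finset.le_sup' ξ hi⟩
  filter_upwards [tendsto_log_natCast_atTop.eventually_gt_atTop 0,
    (tendsto_log_natCast_atTop.const_mul_atTop hx).eventually_gt_atTop (V : ℝ)] with n hL hn
  rw [setOf_le_div_log hL]
  refine measure_mono_null (fun ω hω => ?_) (h.measure_gt_eq_zero hξ hV n)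
  have : (V : ℝ) < Y n ω := hn.trans_le hω
  exact_mod_cast this

/-- With `ξ i` an almost sure upper bound for `Y n` and negative values at most `-1`, the moment is
at most `exp (t ξ i)` times the probability, plus `exp (-t)`. Divide by `exp (t ξ i) ≥ 1` and let `t
→ ∞`. -/
theorem le_measure_nonneg (h : HasUrnMGF P Y S T q a ξ) (hξ : ∀ i ∈ S, ξ i ≤ 0) {i : ℤ}
    (hi : i ∈ T) (hV : ∀ j ∈ T, ξ j ≤ ξ i) (hi0 : 0 ≤ ξ i) (n : ℕ) :
    a i * ∏ k ∈ Finset.range n, (k + 1 + ∑ j ∈ S with ξ j = 0, q j) / ((k : ℝ) + 2) ≤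
      P.real {ω | 0 ≤ (Y n ω : ℝ)} := by
  set c := ∏ k ∈ Finset.range n, (k + 1 + ∑ j ∈ S with ξ j = 0, q j) / ((k : ℝ) + 2) with hc
  have hlim : Tendsto (fun t : ℝ => P.real {ω | 0 ≤ (Y n ω : ℝ)} + Real.exp (t * (-1))) atTop
      (𝓝 (P.real {ω | 0 ≤ (Y n ω : ℝ)})) := by
    simpa using (tendsto_exp_mul_atTop_of_neg (u := -1) (by norm_num)).const_add
      (P.real {ω | 0 ≤ (Y n ω : ℝ)})
  refine ge_of_tendsto hlim ?_
  filter_upwards [eventually_ge_atTop 0] with t ht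
  have hms : MeasurableSet {ω | 0 ≤ (Y n ω : ℝ)} :=
    (h.measurable n) (Set.to_countable {v : ℤ | 0 ≤ (v : ℝ)}).measurableSet
  have hq0 : 0 ≤ ∑ j ∈ S with ξ j = 0, q j :=
    Finset.sum_nonneg fun j hj => (h.step_pos j (Finset.mem_filter.mp hj).1).le
  have lower : a i * Real.exp (t * ξ i) * c ≤ mgf (fun ω => (Y n ω : ℝ)) P t := by
    rw [h.mgf_eq]
    refine mul_le_mul ?_ ?_ (prod_pos hq0 n).le (expSum_nonneg h.init_pos t)
    · exact Finset.single_le_sum (f := fun j => a j * Real.exp (t * ξ j))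
        (fun j hj => (mul_pos (h.init_pos j hj) (Real.exp_pos _)).le) hi
    · refine Finset.prod_le_prod (fun k _ => by positivity) fun k _ => ?_
      have := sum_filter_le_expSum (ξ := ξ) h.step_pos t
      gcongr
  have upper : mgf (fun ω => (Y n ω : ℝ)) P t ≤
      Real.exp (t * ξ i) * P.real {ω | 0 ≤ (Y n ω : ℝ)} + Real.exp (t * (-1)) := by
    have i3 : Integrable (fun ω => Real.exp (t * ξ i) *
        Set.indicator {ω | 0 ≤ (Y n ω : ℝ)} (fun _ => (1 : ℝ)) ω) P :=
      ((integrable_const 1).indicator hms).const_mul _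
    have e3 : ∫ ω, Set.indicator {ω | 0 ≤ (Y n ω : ℝ)} (fun _ => (1 : ℝ)) ω ∂P =
        P.real {ω | 0 ≤ (Y n ω : ℝ)} := by
      rw [integral_indicator_const _ hms]; simp
    have e4 : ∫ _, Real.exp (t * (-1)) ∂P = Real.exp (t * (-1)) := by simp
    rw [← e3, ← integral_const_mul, ← e4, ← integral_add i3 (integrable_const _), mgf]
    refine integral_mono_ae (h.integrable n t) (i3.add (integrable_const _)) ?_
    have hae : ∀ᵐ ω ∂P, Y n ω ≤ ξ i := by
      rw [ae_iff]
      simpa only [not_le] using h.measure_gt_eq_zero hξ hV n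
    filter_upwards [hae] with ω hω
    rcases lt_or_ge (Y n ω) 0 with hneg | hneg
    · have h1 : (Y n ω : ℝ) ≤ -1 := by exact_mod_cast Int.le_sub_one_of_lt hneg
      have h2 := Real.exp_le_exp.mpr (mul_le_mul_of_nonneg_left h1 ht)
      have h3 : 0 ≤ Real.exp (t * ξ i) *
          Set.indicator {ω | 0 ≤ (Y n ω : ℝ)} (fun _ => (1 : ℝ)) ω :=
        mul_nonneg (Real.exp_pos _).le (Set.indicator_nonneg (fun _ _ => zero_le_one) _)
      linarith
    · have h1 : (Y n ω : ℝ) ≤ ξ i := by exact_mod_cast hω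
      have h2 := Real.exp_le_exp.mpr (mul_le_mul_of_nonneg_left h1 ht)
      have h4 : ω ∈ {ω | 0 ≤ (Y n ω : ℝ)} := by
        show (0 : ℝ) ≤ Y n ω
        exact_mod_cast hneg
      rw [Set.indicator_of_mem h4, mul_one]
      linarith [Real.exp_pos (t * (-1))]
  have hξi : (0 : ℝ) ≤ ξ i := by exact_mod_cast hi0
  have hE : 1 ≤ Real.exp (t * ξ i) := Real.one_le_exp (mul_nonneg ht hξi)
  have h5 : Real.exp (t * ξ i) * (a i * c) ≤
      Real.exp (t * ξ i) * (P.real {ω | 0 ≤ (Y n ω : ℝ)} + Real.exp (t * (-1))) := by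
    have := le_mul_of_one_le_left (Real.exp_pos (t * (-1))).le hE
    linarith
  exact le_of_mul_le_mul_left h5 (Real.exp_pos _)

/-- The supremum is approached as `r → ∞` and need not be attained, so the slope argument is
unavailable. The upper bound is Chernoff's at a large fixed `t`. -/
theorem tendsto_tail_of_nonpos_of_eq_zero (h : HasUrnMGF P Y S T q a ξ) (hξ : ∀ i ∈ S, ξ i ≤ 0)
    (hT : ∃ i ∈ T, 0 ≤ ξ i) :
    Tendsto (fun n : ℕ => ((1 / Real.log n : ℝ) : EReal) *
        ENNReal.log (P {ω | 0 ≤ (Y n ω : ℝ) / Real.log n})) atTop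
      (𝓝 (-⨆ r : ℝ, ((0 * r - expSum S q ξ r + 1 : ℝ) : EReal))) := by
  set q₀ := ∑ j ∈ S with ξ j = 0, q j with hq₀
  have hq0 : 0 ≤ q₀ :=
    Finset.sum_nonneg fun j hj => (h.step_pos j (Finset.mem_filter.mp hj).1).le
  have hlim := tendsto_expSum_of_nonpos (q := q) hξ
  have hsup : (⨆ r : ℝ, ((0 * r - expSum S q ξ r + 1 : ℝ) : EReal)) = ((1 - q₀ : ℝ) : EReal) := by
    refine le_antisymm (iSup_le fun r => EReal.coe_le_coe_iff.mpr ?_) ?_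
    · have := sum_filter_le_expSum (ξ := ξ) h.step_pos r
      linarith
    · have h1 : Tendsto (fun r => ((0 * r - expSum S q ξ r + 1 : ℝ) : EReal)) atTop
          (𝓝 ((1 - q₀ : ℝ) : EReal)) := by
        refine EReal.tendsto_coe.mpr ((hlim.const_sub 1).congr fun r => ?_)
        ring
      exact le_of_tendsto' h1 fun r =>
        le_iSup (fun r : ℝ => ((0 * r - expSum S q ξ r + 1 : ℝ) : EReal)) r
  rw [hsup, ← EReal.coe_neg, neg_sub]
  refine tendsto_ereal_log_of_bounds (fun η hη => ?_) (fun η hη => ?_)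
  · obtain ⟨i, hi, hmax⟩ := T.exists_max_image ξ h.init_nonempty
    obtain ⟨j, hj, hj0⟩ := hT
    have hi0 := hj0.trans (hmax j hj)
    have hai := h.init_pos i hi
    have hg := ((tendsto_const_nhds (x := Real.log (a i))).div_atTop
      tendsto_log_natCast_atTop).add (tendsto_log_prod_div_log hq0)
    rw [zero_add] at hg
    have hg' := eventually_exp_bounds (fun n => mul_pos hai (prod_pos hq0 n)) (hg.congr fun n => by
      rw [Real.log_mul hai.ne' (prod_pos hq0 n).ne', add_div]) hη
    filter_upwards [hg', tendsto_log_natCast_atTop.eventually_gt_atTop 0] with n hn hL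
    rw [setOf_le_div_log hL, zero_mul]
    exact hn.1.trans (h.le_measure_nonneg hξ hi hmax hi0 n)
  · obtain ⟨t, h1, ht⟩ := ((hlim.eventually_lt_const
      (lt_add_of_pos_right q₀ (half_pos hη))).and (eventually_ge_atTop 0)).exists
    filter_upwards [h.eventually_tail_le (x := 0) ht (half_pos hη),
      tendsto_log_natCast_atTop.eventually_gt_atTop 0] with n hn hL
    refine hn.trans (Real.exp_le_exp.mpr (mul_le_mul_of_nonneg_left ?_ hL.le))
    linarith

theorem tendsto_tail (h : HasUrnMGF P Y S T q a ξ) (hx : expSumDeriv S q ξ 0 < x)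
    (hdeg : ¬ (x = 0 ∧ (∀ i ∈ S, ξ i ≤ 0) ∧ ∀ i ∈ T, ξ i < 0)) :
    Tendsto (fun n : ℕ => ((1 / Real.log n : ℝ) : EReal) *
        ENNReal.log (P {ω | x ≤ (Y n ω : ℝ) / Real.log n})) atTop
      (𝓝 (-⨆ r : ℝ, ((x * r - expSum S q ξ r + 1 : ℝ) : EReal))) := by
  by_cases hξ : ∀ i ∈ S, ξ i ≤ 0
  · rcases lt_trichotomy x 0 with hx0 | rfl | hx0
    · obtain ⟨t, ht, htx⟩ := exists_expSumDeriv_eq h.step_pos hx (Or.inr ⟨hξ, hx0⟩)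
      refine h.tendsto_tail_of_slope ?_ ht htx
      -- If every step were zero the mean would be `0`, yet it lies below `x < 0`.
      by_contra! hz
      refine (hx.trans hx0).ne (Finset.sum_eq_zero fun i hi => ?_)
      simp [hz i hi]
    · refine h.tendsto_tail_of_nonpos_of_eq_zero hξ ?_
      by_contra! hT
      exact hdeg ⟨rfl, hξ, hT⟩
    · exact h.tendsto_tail_of_nonpos_of_pos hξ hx0
  · push Not at hξ
    obtain ⟨t, ht, htx⟩ := exists_expSumDeriv_eq h.step_pos hx (Or.inl hξ)
    obtain ⟨i, hi, hi0⟩ := hξ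
    exact h.tendsto_tail_of_slope ⟨i, hi, hi0.ne'⟩ ht htx

end HasUrnMGF

/-! ### Application to the urn -/

theorem IsUrnSelection.hasUrnMGF {P : Measure Ω} [IsProbabilityMeasure P] {p U₀ : PMF ℤ}
    {Z : ℕ → Ω → ℤ} (hZ : IsUrnSelection P p U₀ Z) (hp : p.support.Finite)
    (hU₀ : U₀.support.Finite) :
    HasUrnMGF P Z hp.toFinset hU₀.toFinset (fun u => (p u).toReal) (fun v => (U₀ v).toReal) id where
  step_pos i hi := ENNReal.toReal_pos (by simpa using hi) (p.apply_ne_top i)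
  init_pos i hi := ENNReal.toReal_pos (by simpa using hi) (U₀.apply_ne_top i)
  init_nonempty := by simp
  measurable := hZ.measurable
  integrable n t := hZ.integrable_exp (S := hp.toFinset) (T := hU₀.toFinset) (by simp) (by simp) t n
  mgf_eq n t := hZ.mgf_eq (by simp) (by simp) t n

theorem stepMGF_eq_expSum {p : PMF ℤ} (hp : p.support.Finite) (t : ℝ) :
    stepMGF p t = expSum hp.toFinset (fun u => (p u).toReal) id t :=
  PMF.integral_eq_sum_of_support_subset (by simp) _

theorem stepMean_eq_expSumDeriv {p : PMF ℤ} (hp : p.support.Finite) :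
    stepMean p = expSumDeriv hp.toFinset (fun u => (p u).toReal) id 0 := by
  rw [stepMean, PMF.integral_eq_sum_of_support_subset (S := hp.toFinset) (by simp)]
  simp [expSumDeriv]

end Tail

theorem corollary3p4 {Ω : Type*} [MeasurableSpace Ω] (P : Measure Ω) [IsProbabilityMeasure P]
    (p U₀ : PMF ℤ) (hp : p.support.Finite) (hU₀ : U₀.support.Finite)
    (Z : ℕ → Ω → ℤ) (hZ : IsUrnSelection P p U₀ Z) (ε : ℝ) (hε : 0 < ε) :
    (¬ (stepMean p + ε = 0 ∧ (∀ u ∈ p.support, u ≤ 0) ∧ (∀ v ∈ U₀.support, v < 0)) →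
      Tendsto
        (fun n : ℕ => ((1 / Real.log n : ℝ) : EReal) *
          ENNReal.log (P {ω | stepMean p + ε ≤ (Z n ω : ℝ) / Real.log n}))
        atTop (𝓝 (-urnRate p (stepMean p + ε)))) ∧
    (¬ (stepMean p - ε = 0 ∧ (∀ u ∈ p.support, 0 ≤ u) ∧ (∀ v ∈ U₀.support, 0 < v)) →
      Tendsto
        (fun n : ℕ => ((1 / Real.log n : ℝ) : EReal) *
          ENNReal.log (P {ω | (Z n ω : ℝ) / Real.log n ≤ stepMean p - ε}))
        atTop (𝓝 (-urnRate p (stepMean p - ε)))) := by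
  have h := hZ.hasUrnMGF hp hU₀
  have hmean := stepMean_eq_expSumDeriv hp
  constructor
  · intro hdeg
    have := h.tendsto_tail (x := stepMean p + ε) (by rw [← hmean]; linarith) (by simpa using hdeg)
    simpa only [urnRate, stepMGF_eq_expSum hp] using this
  · intro hdeg
    have hneg : ∀ t, expSum hp.toFinset (fun u => (p u).toReal) (fun i => -id i) t =
        stepMGF p (-t) := fun t => by
      rw [stepMGF_eq_expSum hp]; simp [expSum]
    have hderiv : expSumDeriv hp.toFinset (fun u => (p u).toReal) (fun i => -id i) 0 =
        -stepMean p := by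
      rw [hmean]; simp [expSumDeriv]
    have := h.neg.tendsto_tail (x := -(stepMean p - ε)) (by rw [hderiv]; linarith) (by
      rw [neg_eq_zero]; simpa using hdeg)
    -- Substituting `-r` for `r` turns the rate into the Legendre transform of the reflected step
    -- law.
    have hrate : urnRate p (stepMean p - ε) =
        ⨆ r : ℝ, ((-(stepMean p - ε) * r - stepMGF p (-r) + 1 : ℝ) : EReal) := by
      rw [urnRate, ← (Equiv.neg ℝ).iSup_comp]
      simp only [Equiv.neg_apply, mul_neg, neg_mul]
    simp only [hneg] at this
    rw [hrate]
    refine this.congr fun n => ?_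
    congr 3
    ext ω
    simp only [Set.mem_ofPred_eq, Int.cast_neg, neg_div, neg_le_neg_iff]
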